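/- Let $\mathbb K=\mathbb R$ or $\mathbb C$, and let $G=(V,E)$ be a finite connected graph (loops and multiple edges allowed) with a fixed orientation, $E^+$ being the set of positively oriented edges. For $R\in\{\mathbb Z,\mathbb K\}$ let $C_1(G,R)=R^{E^+}$ and $C_0(G,R)=R^V$, let $C^i(G,R)=\mathrm{Hom}_R(C_i(G,R),R)$, let $\partial:C_1(G,R)\to C_0(G,R)$, $\partial e=\overline e-\underline e$ (end vertex minus starting vertex), with transpose $\delta:C^0(G,R)\to C^1(G,R)$, and let $Z_1(G,R)=\ker\partial$. Write $\Omega_1(G)=C_1(G,\mathbb K)$ and $\Omega^1(G)=C^1(G,\mathbb K)$, and let $(e^\star)_{e\in E^+}$ be the basis of $\Omega^1(G)$ dual to $E^+$. Given positive weights $\underline x=(x_e)_{e\in E^+}$, equip $\Omega^1(G)$ with the inner product $\langle\alpha,\beta\rangle=\sum_{e\in E^+}x_e\overline{\alpha(e)}\beta(e)$, let $J_{\underline x}:\Omega_1(G)\to\Omega^1(G)$ be the antilinear isomorphism with $J_{\underline x}e=x_e^{-1}e^\star$, and put $\underline x^{S}=\prod_{e\in S}x_e$ for $S\subseteq E^+$.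 Let $k\ge 0$ be an integer. For a spanning forest $F\subseteq E^+$ (an acyclic spanning subgraph, identified with its set of edges) with $k+1$ connected components, let $B^1(G_{/F},\mathbb Z)\subseteq C^1(G,\mathbb Z)$ be the image under $\delta$ of the integer-valued functions on $V$ that are constant on each component of $F$; it is free of rank $k$. Let $b_F$ be the exterior product of the elements of an integral basis of it, which is well defined up to sign. For $\varphi\in\bigwedge^k\Omega_1(G)$ set $$A^{(k)}_G(\varphi,\underline x)=\sum_F |(\varphi,b_F)|^2\,\underline x^F,$$ where the sum is over the spanning forests $F$ of $G$ with $k+1$ connected components and $(\cdot,\cdot)$ is the duality pairing, $(\phi_1\wedge\dots\wedge\phi_k,\kappa_1\wedge\dots\wedge\kappa_k)=\det(\kappa_j(\phi_i))_{i,j}$. Equip $Z_1(G,\mathbb K)$ with any inner product for which any integral basis of $Z_1(G,\mathbb Z)$ has volume $1$ (Gram determinant $1$), and equip $\mathbb K^k$ with the usual inner product. Let $\phi_1,\dots,\phi_k\in\Omega_1(G)$, let $m:Z_1(G,\mathbb K)\to\Omega_1(G)$ be the inclusion, let $\omega_{\underline\phi}:\mathbb K^k\to\Omega_1(G)$, $(\alpha_1,\dots,\alpha_k)\mapsto\sum_i\alpha_i\phi_i$,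 and define, on the orthogonal direct sum $Z_1(G,\mathbb K)\oplus\mathbb K^k$, the linear operator $$\Box_{\underline\phi}=\bigl(J_{\underline x}(m\oplus\omega_{\underline\phi})\bigr)^*\bigl(J_{\underline x}(m\oplus\omega_{\underline\phi})\bigr),$$ where the adjoint $u^*$ of an antilinear map $u$ is the antilinear map with $\langle u\xi,\beta\rangle=\langle u^*\beta,\xi\rangle$. Then, with $\varphi=\phi_1\wedge\dots\wedge\phi_k$, $$A^{(k)}_G(\varphi,\underline x)=\underline x^{E^+}\,\det\Box_{\underline\phi}.$$ -/

import Mathlib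

/-!
Chains, cochains, cycles and cuts of a finite oriented multigraph, the generating polynomial of
weighted spanning forests, and the Gram operator of the weighted cycle inclusion.
-/

noncomputable section

open scoped ComplexConjugate

/-- A multigraph with vertex set `V`, together with an orientation: `E` is the set of positively
oriented edges, each of which goes from `src e` to `tgt e`. The reversed edge of `e` is not a
separate element of `E`; in the chain groups it is `-e`. Loops and multiple edges are allowed. -/
structure OrientedMultigraph (V E : Type*) where
  src : E → V
  tgt : E → V

namespace OrientedMultigraph

variable {V E : Type*} (G : OrientedMultigraph V E)

section Combinatorics

/-- The spanning subgraph with edge set `S` has an edge between `v` and `w`. -/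
def Joins (S : Set E) (v w : V) : Prop := ∃ e ∈ S, G.src e = v ∧ G.tgt e = w

/-- The relation, on vertices, of being in the same connected component of the spanning
subgraph with edge set `S`. -/
def component (S : Set E) : Setoid V := Relation.EqvGen.setoid (G.Joins S)

/-- The number of connected components of the spanning subgraph with edge set `S`
(isolated vertices count). -/
def numComponents (S : Set E) : ℕ := Nat.card (Quotient (G.component S))

/-- The graph is connected (in particular it has at least one vertex). -/
def IsConnected : Prop := Nonempty V ∧ ∀ v w : V, (G.component Set.univ) v w

/-- The spanning subgraph with edge set `S` has no circuit: no edge `e` of `S` has its two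
endpoints joined by a path in `S` that avoids `e`. -/
def IsAcyclic (S : Set E) : Prop :=
  ∀ e ∈ S, ¬ (G.component (S \ {e})) (G.src e) (G.tgt e)

/-- The spanning forests with `j` connected components, as sets of edges. -/
def forests [Fintype E] (j : ℕ) : Finset (Finset E) :=
  open Classical in
  Finset.univ.filter fun F : Finset E =>
    G.IsAcyclic (F : Set E) ∧ G.numComponents (F : Set E) = j

end Combinatorics

section Chains

variable [DecidableEq V] [DecidableEq E] [Fintype E] (R : Type*) [CommRing R]

/-- The boundary operator `∂ : C₁(G,R) → C₀(G,R)`, `∂ e = tgt e - src e`, where the chain groups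
are `C₁(G,R) = R^E` and `C₀(G,R) = R^V`. -/
def boundary : (E → R) →ₗ[R] (V → R) :=
  Fintype.linearCombination R fun e : E =>
    (Pi.single (G.tgt e) 1 - Pi.single (G.src e) 1 : V → R)

/-- The cycles `Z₁(G,R) = ker ∂`. -/
def cycles : Submodule R (E → R) := LinearMap.ker (G.boundary R)

/-- The coboundary operator `δ : C⁰(G,R) → C¹(G,R)`, the transpose of `∂`, where the cochain
groups are the duals of the chain groups. -/
def coboundary : Module.Dual R (V → R) →ₗ[R] Module.Dual R (E → R) := (G.boundary R).dualMap

/-- The `0`-cochains of the quotient of the graph by `S`: the functions on the vertices that are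
constant on each connected component of the spanning subgraph with edge set `S`. -/
def quotientCochains (S : Set E) : Submodule R (Module.Dual R (V → R)) where
  carrier := {f | ∀ v w : V, (G.component S) v w → f (Pi.single v 1) = f (Pi.single w 1)}
  add_mem' := fun {f g} hf hg v w h => by simp [hf v w h, hg v w h]
  zero_mem' := fun v w _ => by simp
  smul_mem' := fun c f hf v w h => by simp [hf v w h]

/-- The cuts of the quotient of the graph by `S`, a submodule of `C¹(G,R)`. -/
def quotientCuts (S : Set E) : Submodule R (Module.Dual R (E → R)) :=
  (G.quotientCochains R S).map (G.coboundary R)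

end Chains

section Forests

variable [DecidableEq V] [DecidableEq E] [Fintype E] (𝕜 : Type*) [RCLike 𝕜]

/-- The extension of scalars `C¹(G,ℤ) → Ω¹(G) = C¹(G,ℤ) ⊗ 𝕜`. -/
def extendCochain (α : Module.Dual ℤ (E → ℤ)) : Module.Dual 𝕜 (E → 𝕜) :=
  ∑ e : E, ((α (Pi.single e 1) : ℤ) : 𝕜) • LinearMap.proj e

/-- The exterior product in `⋀ᵏ Ω¹(G)` of the elements of a basis of the `ℤ`-module of cuts of
the quotient of the graph by `S`. -/
def wedgeCuts {S : Set E} {k : ℕ} (κ : Module.Basis (Fin k) ℤ (G.quotientCuts ℤ S)) :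
    ⋀[𝕜]^k (Module.Dual 𝕜 (E → 𝕜)) :=
  exteriorPower.ιMulti 𝕜 k fun i => extendCochain 𝕜 (κ i : Module.Dual ℤ (E → ℤ))

variable {𝕜}

/-- The weight `|(φ, b_S)|²` of a spanning subgraph `S` whose quotient has a module of cuts of
rank `k`, for `φ ∈ ⋀ᵏ Ω₁(G)`. Here `b_S` is the exterior product of the elements of an integral
basis of this module; it is defined up to a sign, so that the weight does not depend on the
choice (`cutWeight_eq` below). Subgraphs whose cuts have another rank get the value `0`. -/
def cutWeight {k : ℕ} (φ : ⋀[𝕜]^k (E → 𝕜)) (S : Set E) : ℝ :=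
  open Classical in
  if h : Nonempty (Module.Basis (Fin k) ℤ (G.quotientCuts ℤ S)) then
    ‖exteriorPower.pairingDual 𝕜 (E → 𝕜) k (G.wedgeCuts 𝕜 h.some) φ‖ ^ 2
  else 0

/-- The generating polynomial `A^{(k)}_G(φ, x)` of spanning forests with `k + 1` components, each
weighted by `|(φ, b_F)|²`, in the variables `x_e`. -/
def forestPolynomial {k : ℕ} (φ : ⋀[𝕜]^k (E → 𝕜)) : MvPolynomial E ℝ :=
  ∑ F ∈ G.forests (k + 1),
    MvPolynomial.C (G.cutWeight φ (F : Set E)) * ∏ e ∈ F, MvPolynomial.X e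

/-- Extension of scalars, as an additive map. -/
theorem extendCochain_linear : ∃ L : Module.Dual ℤ (E → ℤ) →ₗ[ℤ] Module.Dual 𝕜 (E → 𝕜),
    ∀ α, L α = extendCochain 𝕜 α :=
  ⟨{ toFun := extendCochain 𝕜
     map_add' := fun α β => by
      simp [extendCochain, add_smul, Finset.sum_add_distrib]
     map_smul' := fun c α => by
      ext e
      simp [extendCochain, Finset.mul_sum, mul_assoc, mul_left_comm] }, fun _ => rfl⟩

/-- The weight may be computed with any integral basis. -/
theorem cutWeight_eq {k : ℕ} (φ : ⋀[𝕜]^k (E → 𝕜)) {S : Set E}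
    (κ : Module.Basis (Fin k) ℤ (G.quotientCuts ℤ S)) :
    G.cutWeight φ S = ‖exteriorPower.pairingDual 𝕜 (E → 𝕜) k (G.wedgeCuts 𝕜 κ) φ‖ ^ 2 := by
  have h : Nonempty (Module.Basis (Fin k) ℤ (G.quotientCuts ℤ S)) := ⟨κ⟩
  rw [cutWeight, dif_pos h]
  set κ' := h.some
  obtain ⟨L, hL⟩ := extendCochain_linear (E := E) (𝕜 := 𝕜)
  let f : (G.quotientCuts ℤ S) [⋀^Fin k]→ₗ[ℤ] ⋀[𝕜]^k (Module.Dual 𝕜 (E → 𝕜)) :=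
    { ((exteriorPower.ιMulti 𝕜 k).toMultilinearMap.restrictScalars ℤ).compLinearMap
        fun _ => L ∘ₗ (G.quotientCuts ℤ S).subtype with
      map_eq_zero_of_eq' := fun v i j hv hij =>
        (exteriorPower.ιMulti 𝕜 k).map_eq_zero_of_eq _ (by simp [hv]) hij }
  have hf : ∀ b : Module.Basis (Fin k) ℤ (G.quotientCuts ℤ S), f b = G.wedgeCuts 𝕜 b := by
    intro b
    change exteriorPower.ιMulti 𝕜 k (fun i => L (b i : Module.Dual ℤ (E → ℤ))) = _
    simp [wedgeCuts, hL]
  have h1 : f κ' = κ.det κ' • f κ := by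
    have h2 : f = (LinearMap.toSpanSingleton ℤ _ (f κ)).compAlternatingMap κ.det := by
      refine κ.ext_alternating fun v hv => ?_
      obtain ⟨σ, rfl⟩ : ∃ σ : Equiv.Perm (Fin k), v = σ :=
        ⟨Equiv.ofBijective v (Finite.injective_iff_bijective.mp hv), rfl⟩
      simp [← Function.comp_def, AlternatingMap.map_perm, Module.Basis.det_self, Units.smul_def]
    simpa using congrArg (fun g => g κ') h2
  rw [← hf, ← hf, h1]
  rcases Int.isUnit_iff.mp (κ.isUnit_det κ') with h2 | h2 <;> simp [h2]

end Forests

end OrientedMultigraph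

section Adjoint

variable {𝕜 M N : Type*} [RCLike 𝕜] [AddCommGroup M] [Module 𝕜 M] [AddCommGroup N] [Module 𝕜 N]

/-- An antilinear map `u` from a finite-dimensional inner product space has a unique adjoint,
the antilinear map `v` with `⟨u x, y⟩ = ⟨v y, x⟩`. -/
theorem existsUnique_antilinearAdjoint [FiniteDimensional 𝕜 M] (cM : InnerProductSpace.Core 𝕜 M)
    (cN : InnerProductSpace.Core 𝕜 N) (u : M →ₗ⋆[𝕜] N) :
    ∃! v : N →ₗ⋆[𝕜] M, ∀ x y, cN.inner (u x) y = cM.inner (v y) x := by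
  let _ : NormedAddCommGroup M := cM.toNormedAddCommGroup
  let _ : InnerProductSpace 𝕜 M := InnerProductSpace.ofCore cM.toCore
  let _ : NormedAddCommGroup N := cN.toNormedAddCommGroup
  let _ : InnerProductSpace 𝕜 N := InnerProductSpace.ofCore cN.toCore
  have : CompleteSpace M := FiniteDimensional.complete 𝕜 M
  have key : ∀ y : N, ∃ z : M, ∀ x, inner 𝕜 (u x) y = inner 𝕜 z x := by
    intro y
    let l : M →ₗ[𝕜] 𝕜 :=
      { toFun := fun x => inner 𝕜 (u x) y
        map_add' := fun a b => by simp [inner_add_left]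
        map_smul' := fun c a => by simp [inner_smul_left] }
    refine ⟨(InnerProductSpace.toDual 𝕜 M).symm (LinearMap.toContinuousLinearMap l), fun x => ?_⟩
    rw [InnerProductSpace.toDual_symm_apply]
    rfl
  choose v hv using key
  have hinj : ∀ a b : M, (∀ x, inner 𝕜 a x = inner 𝕜 b x) → a = b := fun a b h =>
    ext_inner_right 𝕜 h
  refine ⟨{ toFun := v, map_add' := fun a b => ?_, map_smul' := fun c a => ?_ },
    fun x y => hv y x, fun w hw => ?_⟩
  · refine hinj _ _ fun x => ?_
    rw [← hv, inner_add_left, ← hv, ← hv, inner_add_right]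
  · refine hinj _ _ fun x => ?_
    rw [← hv, inner_smul_left, ← hv, inner_smul_right]
    simp
  · ext y
    refine hinj _ _ fun x => ?_
    exact (hw x y).symm.trans (hv y x)

/-- The adjoint `u*` of an antilinear map `u`, for given inner products. -/
def antilinearAdjoint [FiniteDimensional 𝕜 M] (cM : InnerProductSpace.Core 𝕜 M)
    (cN : InnerProductSpace.Core 𝕜 N) (u : M →ₗ⋆[𝕜] N) : N →ₗ⋆[𝕜] M :=
  (existsUnique_antilinearAdjoint cM cN u).choose

theorem antilinearAdjoint_spec [FiniteDimensional 𝕜 M] (cM : InnerProductSpace.Core 𝕜 M)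
    (cN : InnerProductSpace.Core 𝕜 N) (u : M →ₗ⋆[𝕜] N) (x : M) (y : N) :
    cN.inner (u x) y = cM.inner (antilinearAdjoint cM cN u y) x :=
  (existsUnique_antilinearAdjoint cM cN u).choose_spec.1 x y

/-- The inner product on `M × 𝕜^k`, the orthogonal direct sum of `M`, with its given inner
product, and of `𝕜^k`, with the usual one. -/
@[reducible] def sumCore (cM : InnerProductSpace.Core 𝕜 M) (k : ℕ) :
    InnerProductSpace.Core 𝕜 (M × (Fin k → 𝕜)) where
  inner p q := cM.inner p.1 q.1 + ∑ i, conj (p.2 i) * q.2 i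
  conj_inner_symm p q := by
    simp [← cM.conj_inner_symm p.1 q.1, mul_comm]
  re_inner_nonneg p := by
    have h : 0 ≤ RCLike.re (∑ i, conj (p.2 i) * p.2 i) := by
      simp only [RCLike.conj_mul, map_sum]
      exact Finset.sum_nonneg fun i _ => by norm_cast; positivity
    rw [map_add]
    exact add_nonneg (cM.re_inner_nonneg p.1) h
  add_left p q r := by
    simp [cM.add_left, add_mul, Finset.sum_add_distrib]
    ring
  smul_left p q c := by
    simp [cM.smul_left, mul_add, Finset.mul_sum, mul_assoc]
  definite p hp := by
    have h0 : 0 ≤ RCLike.re (cM.inner p.1 p.1) := cM.re_inner_nonneg p.1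
    have h1 : RCLike.re (∑ i, conj (p.2 i) * p.2 i) = ∑ i, ‖p.2 i‖ ^ 2 := by
      simp only [RCLike.conj_mul, map_sum]
      exact Finset.sum_congr rfl fun i _ => by norm_cast
    have h2 : 0 ≤ ∑ i, ‖p.2 i‖ ^ 2 := by positivity
    have h3 := congrArg RCLike.re hp
    rw [map_add, h1, map_zero] at h3
    have h4 : ∑ i, ‖p.2 i‖ ^ 2 = 0 := by linarith
    have h5 : p.2 = 0 := by
      funext i
      have := (Finset.sum_eq_zero_iff_of_nonneg (fun i _ => by positivity)).mp h4 i
        (Finset.mem_univ i)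
      simpa using this
    have h6 : cM.inner p.1 p.1 = 0 := by simpa [h5] using hp
    exact Prod.ext (cM.definite _ h6) h5

end Adjoint

namespace OrientedMultigraph

variable {V E : Type*} (G : OrientedMultigraph V E)
variable [DecidableEq V] [DecidableEq E] [Fintype E] {𝕜 : Type*} [RCLike 𝕜]

/-- The inner product `⟨α, β⟩ = ∑ₑ xₑ conj(α(e)) β(e)` on the space `Ω¹(G)` of `1`-forms. -/
@[reducible] def formCore (x : E → ℝ) (hx : ∀ e, 0 < x e) :
    InnerProductSpace.Core 𝕜 (Module.Dual 𝕜 (E → 𝕜)) where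
  inner α β := ∑ e, (x e : 𝕜) * (conj (α (Pi.single e 1)) * β (Pi.single e 1))
  conj_inner_symm α β := by simp [mul_comm]
  re_inner_nonneg α := by
    simp only [RCLike.conj_mul, map_sum]
    exact Finset.sum_nonneg fun e _ => by
      have := (hx e).le
      norm_cast
      positivity
  add_left α β γ := by simp [add_mul, mul_add, Finset.sum_add_distrib]
  smul_left α β c := by
    simp only [LinearMap.smul_apply, smul_eq_mul, map_mul, Finset.mul_sum]
    exact Finset.sum_congr rfl fun e _ => by ring
  definite α hα := by
    have h1 : ∑ e, x e * ‖α (Pi.single e 1)‖ ^ 2 = 0 := by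
      have := congrArg RCLike.re hα
      simp only [RCLike.conj_mul, map_sum, map_zero] at this
      rw [← this]
      exact Finset.sum_congr rfl fun e _ => by norm_cast
    refine LinearMap.pi_ext' fun e => LinearMap.ext_ring ?_
    have := (Finset.sum_eq_zero_iff_of_nonneg
      (fun e _ => by have := (hx e).le; positivity)).mp h1 e (Finset.mem_univ e)
    have h2 := (hx e).ne'
    simpa [h2] using this

/-- The antilinear isomorphism `J_x : Ω₁(G) → Ω¹(G)`, `e ↦ xₑ⁻¹ e⋆`. -/
def J (x : E → ℝ) : (E → 𝕜) →ₗ⋆[𝕜] Module.Dual 𝕜 (E → 𝕜) where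
  toFun a := ∑ e, (((x e)⁻¹ : ℝ) : 𝕜) • conj (a e) • LinearMap.proj e
  map_add' a b := by simp [add_smul, Finset.sum_add_distrib]
  map_smul' c a := by
    simp only [Pi.smul_apply, smul_eq_mul, map_mul, mul_smul, Finset.smul_sum]
    exact Finset.sum_congr rfl fun e _ => smul_comm _ _ _

/-- An integral cycle is a cycle with coefficients in `𝕜`. -/
def extendCycle (γ : G.cycles ℤ) : G.cycles 𝕜 :=
  ⟨fun e => ((γ : E → ℤ) e : 𝕜), by
    have h : G.boundary ℤ (γ : E → ℤ) = 0 := γ.2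
    change G.boundary 𝕜 _ = 0
    funext v
    have hv := congrArg (Int.cast : ℤ → 𝕜) (congrFun h v)
    simp only [boundary, Fintype.linearCombination_apply, Finset.sum_apply, Pi.smul_apply,
      Pi.sub_apply, Pi.single_apply, smul_eq_mul, Pi.zero_apply, Int.cast_sum, Int.cast_mul,
      Int.cast_sub, Int.cast_ite, Int.cast_one, Int.cast_zero] at hv ⊢
    exact hv⟩

/-- A scalar product on `Z₁(G,𝕜)` for which any integral basis of `Z₁(G,ℤ)` has volume `1`, that
is, has a Gram matrix of determinant `1`. -/
def IsUnimodular (c : InnerProductSpace.Core 𝕜 (G.cycles 𝕜)) : Prop :=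
  ∀ (n : ℕ) (γ : Module.Basis (Fin n) ℤ (G.cycles ℤ)),
    (Matrix.of fun i j : Fin n => c.inner (G.extendCycle (γ i)) (G.extendCycle (γ j))).det = 1

/-- The map `m ⊕ ω_φ : Z₁(G,𝕜) ⊕ 𝕜^k → Ω₁(G)`, where `m` is the inclusion and
`ω_φ(α) = α₁ φ₁ + … + α_k φ_k`. -/
def inclusionSum {k : ℕ} (φ : Fin k → E → 𝕜) : (G.cycles 𝕜 × (Fin k → 𝕜)) →ₗ[𝕜] (E → 𝕜) :=
  (G.cycles 𝕜).subtype.coprod (Fintype.linearCombination 𝕜 φ)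

/-- The linear operator `□_φ = (J_x (m ⊕ ω_φ))* (J_x (m ⊕ ω_φ))` on `Z₁(G,𝕜) ⊕ 𝕜^k`. -/
def box (x : E → ℝ) (hx : ∀ e, 0 < x e) (c : InnerProductSpace.Core 𝕜 (G.cycles 𝕜)) {k : ℕ}
    (φ : Fin k → E → 𝕜) : (G.cycles 𝕜 × (Fin k → 𝕜)) →ₗ[𝕜] (G.cycles 𝕜 × (Fin k → 𝕜)) :=
  (antilinearAdjoint (sumCore c k) (formCore x hx) ((J x).comp (G.inclusionSum φ))).comp
    ((J x).comp (G.inclusionSum φ))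

end OrientedMultigraph

end

/-! Choose an integral basis γ of Z₁(G,ℤ), of rank g, and let M be the matrix whose rows are the γ i
and the φ j and whose columns are the edges. Since γ has volume 1, `det_box` gives det □ = det(M D
M*) with D = diag(xₑ⁻¹): the weight xₑ of the inner product on forms meets two factors xₑ⁻¹ coming
from `J`. Cauchy–Binet expands this over sets of g + k edges, and multiplying by ∏ xₑ turns the term
of Fᶜ into |M_{Fᶜ}|² x^F, where M_{Fᶜ} is the minor on the columns outside F.

It remains to evaluate these minors. If F contains a circuit, a nonzero cycle vanishes on Fᶜ and the
minor is zero. If F is acyclic, an Euler characteristic count shows that |Fᶜ| = g + k exactly when F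
has k + 1 components. For such F, let κ be an integral basis of the cuts of G/F. The cut lattice is
saturated, so κ has a dual family of integral chains ε, and γ, ε and the edges of F together form a
ℤ-basis of ℤ^E (`exists_adaptedBasis`). Its matrix in the basis of edges has determinant ±1. In this
basis, the rows γ, φ and the edges of F become a block triangular matrix whose only nontrivial
diagonal block is (κ_j(φ_i)); hence |M_{Fᶜ}| = |(φ, b_F)|. -/

open scoped ComplexConjugate

/-! ### Cauchy–Binet and Gram determinants. -/

section Determinants

namespace Matrix

variable {n m R : Type*} [Fintype n] [DecidableEq n] [Fintype m] [CommRing R]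

/-- Expansion of the determinant of a product of rectangular matrices over all choice functions. -/
theorem det_mul_eq_sum_fun (A : Matrix n m R) (B : Matrix m n R) :
    (A * B).det = ∑ p : n → m, (∏ i, A i (p i)) * (B.submatrix p id).det := by
  have h : A * B = fun i => ∑ e, A i e • B e := by
    ext i j
    simp [mul_apply, Finset.sum_apply]
  change (detRowAlternating (R := R)).toMultilinearMap (A * B) = _
  rw [h, MultilinearMap.map_sum]
  refine Finset.sum_congr rfl fun p _ => ?_
  rw [MultilinearMap.map_smul_univ]
  rfl

variable [DecidableEq m]

/-- The **Cauchy–Binet formula**. -/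
theorem det_mul_eq_sum_minors (A : Matrix n m R) (B : Matrix m n R)
    (e : ∀ S : Finset m, S.card = Fintype.card n → (n ≃ S)) :
    (A * B).det = ∑ S : Finset m, if h : S.card = Fintype.card n then
      (A.submatrix id fun i => (e S h i : m)).det * (B.submatrix (fun i => (e S h i : m)) id).det
      else 0 := by
  -- Choice functions are grouped by their image S. If |S| is the number of rows they are the
  -- bijections onto S, that is, permutations composed with `e S h`; otherwise they are not
  -- injective and repeat a row of B.
  rw [det_mul_eq_sum_fun, ← Finset.sum_fiberwise Finset.univ (fun p : n → m => Finset.univ.image p)]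
  refine Finset.sum_congr rfl fun S _ => ?_
  split_ifs with h
  · have hA : (A.submatrix id fun i => (e S h i : m)).det
        = ∑ σ : Equiv.Perm n, ((Equiv.Perm.sign σ : ℤ) : R) * ∏ i, A i (e S h (σ i)) := by
      rw [← det_transpose, det_apply']
      simp
    rw [hA, Finset.sum_mul]
    symm
    refine Finset.sum_bij (fun (σ : Equiv.Perm n) _ i => (e S h (σ i) : m)) ?_ ?_ ?_ ?_
    · intro σ _
      simp only [Finset.mem_filter, Finset.mem_univ, true_and]
      ext a
      simp only [Finset.mem_image, Finset.mem_univ, true_and]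
      refine ⟨?_, fun ha => ⟨σ.symm ((e S h).symm ⟨a, ha⟩), by simp⟩⟩
      rintro ⟨i, rfl⟩
      exact (e S h (σ i)).2
    · intro σ _ τ _ hst
      ext i
      exact (e S h).injective (Subtype.ext (congrFun hst i))
    · intro p hp
      have hp' : Finset.univ.image p = S := by simpa using hp
      have hmem : ∀ i, p i ∈ S := fun i => hp' ▸ Finset.mem_image_of_mem p (Finset.mem_univ i)
      have hinj : Function.Injective p := by
        have : (Finset.univ.image p).card = (Finset.univ : Finset n).card := by
          rw [hp', h, Finset.card_univ]
        simpa using Finset.card_image_iff.mp this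
      let q : n → n := fun i => (e S h).symm ⟨p i, hmem i⟩
      have hq : Function.Injective q := fun i j hij =>
        hinj (congrArg Subtype.val ((e S h).symm.injective hij))
      exact ⟨Equiv.ofBijective q (Finite.injective_iff_bijective.mp hq), Finset.mem_univ _,
        by ext i; simp [q]⟩
    · intro σ _
      have : B.submatrix (fun i => (e S h (σ i) : m)) id =
          (B.submatrix (fun i => (e S h i : m)) id).submatrix σ id := rfl
      rw [this, det_permute]
      ring
  · refine Finset.sum_eq_zero fun p hp => ?_
    have hp' : Finset.univ.image p = S := by simpa using hp
    have hninj : ¬ Function.Injective p := fun hi => h (by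
      rw [← hp', Finset.card_image_of_injective _ hi, Finset.card_univ])
    rw [Function.not_injective_iff] at hninj
    obtain ⟨i, j, hij, hne⟩ := hninj
    rw [det_zero_of_row_eq hne (by ext l; simp [hij]), mul_zero]

end Matrix

/-- The determinant of an endomorphism times the Gram determinant of a basis. -/
theorem InnerProductSpace.Core.det_inner_apply {𝕜 M ι : Type*} [RCLike 𝕜] [AddCommGroup M]
    [Module 𝕜 M] [Fintype ι] [DecidableEq ι] (c : InnerProductSpace.Core 𝕜 M)
    (b : Module.Basis ι 𝕜 M) (T : M →ₗ[𝕜] M) :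
    (Matrix.of fun i j => c.inner (b i) (T (b j))).det =
      (Matrix.of fun i j => c.inner (b i) (b j)).det * LinearMap.det T := by
  let _ : NormedAddCommGroup M := c.toNormedAddCommGroup
  let _ : InnerProductSpace 𝕜 M := InnerProductSpace.ofCore c.toCore
  rw [← LinearMap.det_toMatrix b, ← Matrix.det_mul]
  congr 1
  ext i j
  change inner 𝕜 (b i) (T (b j)) = ∑ l, inner 𝕜 (b i) (b l) * LinearMap.toMatrix b b T l j
  conv_lhs => rw [← b.sum_repr (T (b j)), inner_sum]
  simp only [inner_smul_right, LinearMap.toMatrix_apply, mul_comm]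

end Determinants

namespace OrientedMultigraph

/-! ### Integral cycles and cuts. -/

section CycleLattice

variable {V E : Type*} (G : OrientedMultigraph V E)

theorem component_of_mem {S : Set E} {e : E} (he : e ∈ S) :
    (G.component S) (G.src e) (G.tgt e) :=
  Relation.EqvGen.rel _ _ ⟨e, he, rfl, rfl⟩

/-- A function which takes equal values at the ends of each edge is constant. -/
theorem eq_of_connected {α : Type*} (hG : G.IsConnected) {h : V → α}
    (hh : ∀ e, h (G.src e) = h (G.tgt e)) (v w : V) : h v = h w := by
  have hvw : Relation.EqvGen (G.Joins Set.univ) v w := hG.2 v w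
  induction hvw with
  | rel v w h =>
    obtain ⟨e, _, rfl, rfl⟩ := h
    exact hh e
  | refl v => rfl
  | symm v w _ ih => exact ih.symm
  | trans u v w _ _ ih₁ ih₂ => exact ih₁.trans ih₂

variable [DecidableEq V] [DecidableEq E] [Fintype E]

theorem boundary_single (R : Type*) [CommRing R] (e : E) :
    G.boundary R (Pi.single e 1) = Pi.single (G.tgt e) 1 - Pi.single (G.src e) 1 := by
  simp [boundary]

/-- The endpoints of a path in `S` differ by the boundary of a chain supported in `S`. -/
theorem exists_boundary_eq_of_component (R : Type*) [CommRing R] {S : Set E} {v w : V}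
    (h : (G.component S) v w) :
    ∃ z : E → R, (∀ e ∉ S, z e = 0) ∧
      G.boundary R z = Pi.single w 1 - Pi.single v 1 := by
  change Relation.EqvGen (G.Joins S) v w at h
  induction h with
  | rel v w h =>
    obtain ⟨e, he, rfl, rfl⟩ := h
    refine ⟨Pi.single e 1, fun a ha => ?_, G.boundary_single R e⟩
    rw [Pi.single_apply, if_neg]
    rintro rfl
    exact ha he
  | refl v => exact ⟨0, by simp⟩
  | symm v w _ ih =>
    obtain ⟨z, hz, hb⟩ := ih
    exact ⟨-z, fun e he => by simp [hz e he], by rw [map_neg, hb, neg_sub]⟩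
  | trans u v w _ _ ih₁ ih₂ =>
    obtain ⟨z₁, hz₁, hb₁⟩ := ih₁
    obtain ⟨z₂, hz₂, hb₂⟩ := ih₂
    exact ⟨z₁ + z₂, fun e he => by simp [hz₁ e he, hz₂ e he], by rw [map_add, hb₁, hb₂]; abel⟩

theorem coboundary_single {R : Type*} [CommRing R] (f : Module.Dual R (V → R)) (e : E) :
    G.coboundary R f (Pi.single e 1) =
      f (Pi.single (G.tgt e) 1) - f (Pi.single (G.src e) 1) := by
  rw [coboundary, LinearMap.dualMap_apply, boundary_single, map_sub]

theorem coboundary_single_of_mem {R : Type*} [CommRing R] {S : Set E}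
    {f : Module.Dual R (V → R)} (hf : f ∈ G.quotientCochains R S) {e : E} (he : e ∈ S) :
    G.coboundary R f (Pi.single e 1) = 0 := by
  rw [coboundary_single, hf _ _ (G.component_of_mem he), sub_self]

variable [Fintype V]

/-- A subgraph is acyclic if and only if it supports no integral cycle. -/
theorem isAcyclic_iff_forall_cycles {S : Set E} :
    G.IsAcyclic S ↔ ∀ z ∈ G.cycles ℤ, (∀ e ∉ S, z e = 0) → z = 0 := by
  classical
  constructor
  · intro hS z hz hzS
    funext e
    by_cases he : e ∈ S
    swap
    · exact hzS e he
    -- The coboundary of this component indicator vanishes on S \ {e} and is -1 on e, so its value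
    -- on z is -z e; it is also 0, since z is a cycle.
    let f : Module.Dual ℤ (V → ℤ) := Fintype.linearCombination ℤ
      fun v => if (G.component (S \ {e})) (G.src e) v then 1 else 0
    have hf : ∀ v, f (Pi.single v 1) =
        if (G.component (S \ {e})) (G.src e) v then 1 else 0 := by simp [f]
    have hfz : G.coboundary ℤ f z = 0 := by
      have hz' : G.boundary ℤ z = 0 := hz
      rw [coboundary, LinearMap.dualMap_apply, hz', map_zero]
    have hfq : f ∈ G.quotientCochains ℤ (S \ {e}) := by
      intro v w hvw
      rw [hf, hf]
      exact if_congr ⟨fun h => (G.component _).trans h hvw,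
        fun h => (G.component _).trans h ((G.component _).symm hvw)⟩ rfl rfl
    rw [pi_eq_sum_univ' z, map_sum, Finset.sum_eq_single e] at hfz
    · rw [map_smul, coboundary_single, hf, hf, if_neg (hS e he),
        if_pos ((G.component _).refl _)] at hfz
      simpa using hfz
    · intro a _ hae
      rw [map_smul]
      by_cases ha : a ∈ S
      · rw [G.coboundary_single_of_mem hfq ⟨ha, hae⟩, smul_zero]
      · rw [hzS a ha, zero_smul]
    · simp
  · intro h e he hc
    obtain ⟨w, hw, hb⟩ := G.exists_boundary_eq_of_component ℤ hc
    -- The edge e minus a path avoiding it between the same endpoints is a cycle in S with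
    -- coefficient 1 at e.
    have hz := h (Pi.single e 1 - w) (by
      change G.boundary ℤ _ = 0
      rw [map_sub, hb, boundary_single, sub_self]) (by
      intro a ha
      have hae : a ≠ e := by rintro rfl; exact ha he
      simp [hae, hw a fun h => ha h.1])
    have := congrFun hz e
    simp [hw e fun h => h.2 rfl] at this

/-- A `0`-chain annihilated by all cochains of the quotient by `S` bounds in `S`. -/
theorem exists_boundary_eq_of_forall_quotientCochains {S : Set E} {y : V → ℤ}
    (hy : ∀ f ∈ G.quotientCochains ℤ S, f y = 0) :
    ∃ z : E → ℤ, (∀ e ∉ S, z e = 0) ∧ G.boundary ℤ z = y := by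
  classical
  let q : V → V := fun v => (Quotient.mk (G.component S) v).out
  have hq : ∀ v, (G.component S) (q v) v := fun v =>
    Quotient.exact (Quotient.out_eq (Quotient.mk (G.component S) v))
  have hqq : ∀ v w, (G.component S) v w → q v = q w := fun v w h => by
    simp only [q]
    rw [Quotient.sound h]
  choose z hz hb using fun v => G.exists_boundary_eq_of_component ℤ (hq v)
  refine ⟨∑ v, y v • z v, fun e he => by simp [hz _ e he], ?_⟩
  -- Moving y along paths in S to the representatives leaves at each of them the total of y on its
  -- component, which is the value on y of the indicator of that component.
  have h0 : ∑ v, y v • (Pi.single (q v) 1 : V → ℤ) = 0 := by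
    funext u
    have h := hy (Fintype.linearCombination ℤ fun v => if q v = u then 1 else 0) (by
      intro v w hvw
      simp [hqq v w hvw])
    rw [Fintype.linearCombination_apply] at h
    rw [Finset.sum_apply, Pi.zero_apply, ← h]
    refine Finset.sum_congr rfl fun v _ => ?_
    rw [Pi.smul_apply, Pi.single_apply]
    simp only [eq_comm]
  simp only [map_sum, map_smul, hb, smul_sub, Finset.sum_sub_distrib, h0, sub_zero]
  exact (pi_eq_sum_univ' y).symm

/-- The lattice of cuts of a quotient of a connected graph is saturated. -/
theorem mem_quotientCuts_of_smul_mem (hG : G.IsConnected) {S : Set E} {n : ℤ} (hn : n ≠ 0)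
    {a : Module.Dual ℤ (E → ℤ)} (ha : n • a ∈ G.quotientCuts ℤ S) :
    a ∈ G.quotientCuts ℤ S := by
  obtain ⟨f, hf, hfa⟩ := ha
  obtain ⟨v₀⟩ := hG.1
  have hedge : ∀ e, f (Pi.single (G.tgt e) 1) - f (Pi.single (G.src e) 1)
      = n * a (Pi.single e 1) := fun e => by
    rw [← coboundary_single, hfa]
    rfl
  -- The potential f of n • a is constant modulo n along edges, hence everywhere by connectedness;
  -- (f - f v₀) / n is then an integral potential of a.
  have hmod : ∀ v, n ∣ f (Pi.single v 1) - f (Pi.single v₀ 1) := by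
    intro v
    have := G.eq_of_connected hG (h := fun v => (f (Pi.single v 1) : ℤ) % n) (fun e => by
      refine Int.ModEq.eq ((Int.modEq_iff_dvd).2 ⟨_, hedge e⟩)) v₀ v
    exact (Int.modEq_iff_dvd).1 this
  choose h hh using hmod
  refine ⟨Fintype.linearCombination ℤ h, fun v w hvw => ?_, ?_⟩
  · simp only [Fintype.linearCombination_apply_single, one_smul]
    refine mul_left_cancel₀ hn ?_
    rw [← hh, ← hh, hf v w hvw]
  · refine LinearMap.pi_ext' fun e => LinearMap.ext_ring ?_
    simp only [LinearMap.comp_apply, LinearMap.single_apply, coboundary_single,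
      Fintype.linearCombination_apply_single, one_smul]
    refine mul_left_cancel₀ hn ?_
    rw [mul_sub, ← hh, ← hh, ← hedge]
    ring

/-- A basis of the cuts of a quotient of a connected graph has a dual family of `1`-chains. -/
theorem exists_dual_chains (hG : G.IsConnected) {S : Set E} {r : ℕ}
    (κ : Module.Basis (Fin r) ℤ (G.quotientCuts ℤ S)) :
    ∃ ε : Fin r → E → ℤ, ∀ i j,
      (κ i : Module.Dual ℤ (E → ℤ)) (ε j) = if i = j then 1 else 0 := by
  let B := G.quotientCuts ℤ S
  -- Saturation makes the quotient torsion-free, hence free, so B is a direct summand with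
  -- projection ρ. The coordinates composed with ρ are functionals on cochains, which are chains by
  -- reflexivity.
  have : Module.IsTorsionFree ℤ (Module.Dual ℤ (E → ℤ) ⧸ B) := by
    refine Module.IsTorsionFree.of_smul_eq_zero fun n a hna => ?_
    obtain ⟨a, rfl⟩ := B.mkQ_surjective a
    refine or_iff_not_imp_left.mpr fun hn => ?_
    rw [← map_smul, ← LinearMap.mem_ker, Submodule.ker_mkQ] at hna
    rw [← LinearMap.mem_ker, Submodule.ker_mkQ]
    exact G.mem_quotientCuts_of_smul_mem hG hn hna
  have : Module.Free ℤ (Module.Dual ℤ (E → ℤ) ⧸ B) := inferInstance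
  obtain ⟨s, hs⟩ := Module.projective_lifting_property B.mkQ LinearMap.id B.mkQ_surjective
  let ρ : Module.Dual ℤ (E → ℤ) →ₗ[ℤ] B := (LinearMap.id - s ∘ₗ B.mkQ).codRestrict B (by
    intro a
    refine (Submodule.Quotient.mk_eq_zero B).mp ?_
    rw [← Submodule.mkQ_apply]
    have := LinearMap.congr_fun hs (B.mkQ a)
    simp only [LinearMap.comp_apply, LinearMap.id_apply] at this
    simp only [LinearMap.sub_apply, LinearMap.id_apply, LinearMap.comp_apply, map_sub, this,
      sub_self])
  have hρ : ∀ b : B, ρ b = b := by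
    intro b
    ext1
    have : B.mkQ (b : Module.Dual ℤ (E → ℤ)) = 0 := by simp
    simp only [ρ, LinearMap.codRestrict_apply, LinearMap.sub_apply, LinearMap.id_apply,
      LinearMap.comp_apply, this, map_zero, sub_zero]
  refine ⟨fun j => (Module.evalEquiv ℤ (E → ℤ)).symm (κ.coord j ∘ₗ ρ), fun i j => ?_⟩
  rw [Module.apply_evalEquiv_symm_apply, LinearMap.comp_apply, hρ]
  simp [Finsupp.single_apply]

end CycleLattice
end OrientedMultigraph

namespace OrientedMultigraph

/-! ### Lattice bases adapted to a forest. -/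

section AdaptedBasis

variable {V E : Type*} (G : OrientedMultigraph V E)
variable [DecidableEq V] [DecidableEq E] [Fintype E]

/-- The chains given by an integral basis of the cycles, chains dual to a basis of the cuts of
the quotient by `S`, and the edges of `S`. -/
def adaptedFamily {g r : ℕ} (γ : Fin g → G.cycles ℤ) (S : Set E) (ε : Fin r → E → ℤ) :
    (Fin g ⊕ Fin r) ⊕ S → E → ℤ :=
  Sum.elim (Sum.elim (fun i => (γ i : E → ℤ)) ε) fun e => Pi.single (e : E) 1

/-- The cuts of the quotient by `S` vanish on the cycles and on the edges of `S`. -/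
theorem quotientCuts_apply_eq_zero {S : Set E} {b : Module.Dual ℤ (E → ℤ)}
    (hb : b ∈ G.quotientCuts ℤ S) :
    (∀ z ∈ G.cycles ℤ, b z = 0) ∧ ∀ e ∈ S, b (Pi.single e 1) = 0 := by
  obtain ⟨f, hf, rfl⟩ := hb
  refine ⟨fun z hz => ?_, fun e he => G.coboundary_single_of_mem hf he⟩
  have hz' : G.boundary ℤ z = 0 := hz
  rw [coboundary, LinearMap.dualMap_apply, hz', map_zero]

variable [Fintype V]

/-- The lattice of cuts of the quotient of a connected graph by `S` has as rank the number of
components of `S` minus one. -/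
theorem finrank_quotientCuts_add_one (hG : G.IsConnected) (S : Set E) :
    Module.finrank ℤ (G.quotientCuts ℤ S) + 1 = G.numComponents S := by
  classical
  let Q := Quotient (G.component S)
  have : Fintype Q := Fintype.ofFinite Q
  let T : (Q → ℤ) →ₗ[ℤ] Module.Dual ℤ (V → ℤ) :=
    { toFun h := Fintype.linearCombination ℤ fun v => h (Quotient.mk _ v)
      map_add' a b := by
        refine LinearMap.pi_ext' fun v => LinearMap.ext_ring ?_
        simp
      map_smul' a b := by
        refine LinearMap.pi_ext' fun v => LinearMap.ext_ring ?_
        simp }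
  have hT : ∀ h v, T h (Pi.single v 1) = h (Quotient.mk _ v) := by simp [T]
  have hrange : LinearMap.range T = G.quotientCochains ℤ S := by
    ext f
    constructor
    · rintro ⟨h, rfl⟩ v w hvw
      rw [hT, hT, Quotient.sound hvw]
    · intro hf
      refine ⟨Quotient.lift (fun v => f (Pi.single v 1)) hf, ?_⟩
      refine LinearMap.pi_ext' fun v => LinearMap.ext_ring ?_
      rw [LinearMap.comp_apply, LinearMap.single_apply, hT]
      rfl
  have hcuts : LinearMap.range (G.coboundary ℤ ∘ₗ T) = G.quotientCuts ℤ S := by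
    rw [LinearMap.range_comp, hrange, quotientCuts]
  obtain ⟨v₀⟩ := hG.1
  -- The constants are the whole kernel because G is connected; they account for the + 1 in
  -- rank–nullity.
  have hker : LinearMap.ker (G.coboundary ℤ ∘ₗ T) = Submodule.span ℤ {1} := by
    ext h
    rw [LinearMap.mem_ker, LinearMap.comp_apply, Submodule.mem_span_singleton]
    constructor
    · intro hh
      refine ⟨h (Quotient.mk _ v₀), ?_⟩
      funext q
      obtain ⟨v, rfl⟩ := Quotient.exists_rep q
      have := G.eq_of_connected hG (h := fun v => h (Quotient.mk (G.component S) v)) (fun e => by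
        have := G.coboundary_single (T h) e
        rw [hh, hT, hT] at this
        exact (sub_eq_zero.mp this.symm).symm) v₀ v
      simpa using this
    · rintro ⟨a, rfl⟩
      refine LinearMap.pi_ext' fun e => LinearMap.ext_ring ?_
      simp [coboundary_single, hT]
  have h1 := Submodule.finrank_quotient_add_finrank (LinearMap.ker (G.coboundary ℤ ∘ₗ T))
  rw [(LinearMap.quotKerEquivRange _).finrank_eq] at h1
  have hone : (1 : Q → ℤ) ≠ 0 := fun h => one_ne_zero (congrFun h (Quotient.mk _ v₀))
  rw [hcuts, hker, Module.finrank_fintype_fun_eq_card] at h1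
  rw [numComponents, Nat.card_eq_fintype_card, ← h1]
  congr 1
  have := (LinearEquiv.toSpanNonzeroSingleton ℤ (Q → ℤ) 1 hone).finrank_eq
  simpa using this

/-- If `S` is acyclic, the adapted family is a basis of the lattice of `1`-chains. -/
theorem exists_adaptedBasis {S : Set E} (hS : G.IsAcyclic S) {g r : ℕ}
    (γ : Module.Basis (Fin g) ℤ (G.cycles ℤ)) (κ : Module.Basis (Fin r) ℤ (G.quotientCuts ℤ S))
    (ε : Fin r → E → ℤ)
    (hε : ∀ i j, (κ i : Module.Dual ℤ (E → ℤ)) (ε j) = if i = j then 1 else 0) :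
    ∃ b : Module.Basis ((Fin g ⊕ Fin r) ⊕ S) ℤ (E → ℤ), ⇑b = G.adaptedFamily γ S ε := by
  classical
  have : Fintype S := Fintype.ofFinite S
  have hκ := fun j => G.quotientCuts_apply_eq_zero (κ j).2
  have hli : LinearIndependent ℤ (G.adaptedFamily γ S ε) := by
    rw [Fintype.linearIndependent_iff]
    intro a ha
    simp only [adaptedFamily, Fintype.sum_sum_type, Sum.elim_inl, Sum.elim_inr] at ha
    -- The cut κ j kills the cycles and the edges of S, so it isolates the coefficient of ε j. What
    -- remains equates a cycle with a chain supported in S, and acyclicity makes both vanish.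
    have hr : ∀ j, a (Sum.inl (Sum.inr j)) = 0 := by
      intro j
      have := congrArg (κ j : Module.Dual ℤ (E → ℤ)) ha
      have h1 : ∀ i, (κ j : Module.Dual ℤ (E → ℤ)) (γ i) = 0 := fun i => (hκ j).1 _ (γ i).2
      have h2 : ∀ s : S, (κ j : Module.Dual ℤ (E → ℤ)) (Pi.single (s : E) 1) = 0 :=
        fun s => (hκ j).2 _ s.2
      simpa only [map_add, map_sum, map_smul, map_zero, h1, h2, hε, smul_eq_mul, mul_zero, zero_add,
        add_zero, mul_ite, mul_one, Finset.sum_const_zero, Finset.sum_ite_eq, Finset.mem_univ, if_true] using this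
    simp only [hr, zero_smul, Finset.sum_const_zero, add_zero] at ha
    have hz : ∑ i, a (Sum.inl (Sum.inl i)) • γ i = 0 := by
      ext1
      refine G.isAcyclic_iff_forall_cycles.mp hS _ (Subtype.prop _) fun e he => ?_
      have := congrFun ha e
      have h0 : ∀ s : S, (Pi.single (s : E) 1 : E → ℤ) e = 0 := fun s => by
        rw [Pi.single_apply, if_neg]
        rintro rfl
        exact he s.2
      simpa [h0] using this
    have hg : ∀ i, a (Sum.inl (Sum.inl i)) = 0 :=
      Fintype.linearIndependent_iff.mp γ.linearIndependent _ hz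
    simp only [hg, zero_smul, Finset.sum_const_zero, zero_add] at ha
    rintro ((i | j) | s)
    · exact hg i
    · exact hr j
    · have := congrFun ha s
      simpa [Pi.single_apply, Subtype.coe_inj] using this
  refine ⟨Module.Basis.mk hli ?_, Module.Basis.coe_mk _ _⟩
  intro z _
  set W := Submodule.span ℤ (Set.range (G.adaptedFamily γ S ε))
  have hW : ∀ i, G.adaptedFamily γ S ε i ∈ W := fun i => Submodule.subset_span ⟨i, rfl⟩
  have hWε : ∀ j, ε j ∈ W := fun j => hW (Sum.inl (Sum.inr j))
  have hWS : ∀ y : E → ℤ, (∀ e ∉ S, y e = 0) → y ∈ W := by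
    intro y hy
    rw [pi_eq_sum_univ' y]
    refine Submodule.sum_mem _ fun e _ => ?_
    by_cases he : e ∈ S
    · exact Submodule.smul_mem _ _ (hW (Sum.inr ⟨e, he⟩))
    · rw [hy e he, zero_smul]
      exact Submodule.zero_mem _
  have hWZ : ∀ y ∈ G.cycles ℤ, y ∈ W := by
    intro y hy
    have := congrArg Subtype.val (γ.sum_repr ⟨y, hy⟩)
    rw [AddSubmonoidClass.coe_finsetSum] at this
    rw [← show _ = y from this]
    exact Submodule.sum_mem _ fun i _ => Submodule.smul_mem _ _ (hW (Sum.inl (Sum.inl i)))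
  -- Removing the ε-part leaves a chain y killed by all cuts. Its boundary is then killed by every
  -- quotient cochain, hence bounds a chain w in S, and y - w is a cycle.
  set y := z - ∑ j, (κ j : Module.Dual ℤ (E → ℤ)) z • ε j
  have hy : ∀ b ∈ G.quotientCuts ℤ S, b y = 0 := by
    intro b hb
    have hκy : ∀ j, (κ j : Module.Dual ℤ (E → ℤ)) y = 0 := by
      intro j
      simp only [y, map_sub, map_sum, map_smul, hε, smul_eq_mul, mul_ite, mul_one, mul_zero,
        Finset.sum_ite_eq, Finset.mem_univ, if_true, sub_self]
    have := congrArg Subtype.val (κ.sum_repr ⟨b, hb⟩)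
    rw [AddSubmonoidClass.coe_finsetSum] at this
    rw [← show _ = b from this]
    simp [hκy]
  obtain ⟨w, hw, hb⟩ := G.exists_boundary_eq_of_forall_quotientCochains (S := S)
    (y := G.boundary ℤ y) fun f hf => hy _ ⟨f, hf, rfl⟩
  have hzy : z = (y - w) + w + ∑ j, (κ j : Module.Dual ℤ (E → ℤ)) z • ε j := by simp [y]
  rw [hzy]
  refine Submodule.add_mem _ (Submodule.add_mem _ (hWZ _ ?_) (hWS _ hw))
    (Submodule.sum_mem _ fun j _ => Submodule.smul_mem _ _ (hWε j))
  change G.boundary ℤ _ = 0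
  rw [map_sub, hb, sub_self]

end AdaptedBasis
end OrientedMultigraph

/-- An integral basis of `ℤ^E` is a basis of `𝕜^E`, whose matrix has a determinant of norm `1`. -/
theorem Module.Basis.exists_extend_int (𝕜 : Type*) [RCLike 𝕜] {ι E : Type*} [Fintype ι]
    [DecidableEq ι] [Fintype E] [DecidableEq E] (t : ι ≃ E) (b : Module.Basis ι ℤ (E → ℤ)) :
    ∃ b' : Module.Basis ι 𝕜 (E → 𝕜), (∀ i e, b' i e = (b i e : 𝕜)) ∧
      ‖(Matrix.of fun i j => b' i (t j)).det‖ = 1 := by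
  let v : ι → E → 𝕜 := fun i e => (b i e : 𝕜)
  -- A change of basis over ℤ has determinant ±1, which survives the passage to 𝕜.
  have hu := ((Pi.basisFun ℤ E).reindex t.symm).isUnit_det b
  rw [Module.Basis.det_apply] at hu
  have hdet : ((Pi.basisFun 𝕜 E).reindex t.symm).det v =
      ((((Pi.basisFun ℤ E).reindex t.symm).toMatrix b).det : ℤ) := by
    rw [Module.Basis.det_apply, Int.cast_det]
    congr 1
  have hv : IsUnit (((Pi.basisFun 𝕜 E).reindex t.symm).det v) := by
    rw [hdet]
    exact hu.map (Int.castRingHom 𝕜)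
  have hb := (is_basis_iff_det _).mpr hv
  refine ⟨Module.Basis.mk hb.1 hb.2.ge, fun i e => by simp [v], ?_⟩
  have : (Matrix.of fun i j => Module.Basis.mk hb.1 hb.2.ge i (t j)).det =
      ((Pi.basisFun 𝕜 E).reindex t.symm).det v := by
    rw [Module.Basis.det_apply, ← Matrix.det_transpose]
    congr 1
    ext i j
    simp [Module.Basis.toMatrix_apply]
  rw [this, hdet]
  rcases Int.isUnit_iff.mp hu with h | h <;> rw [h] <;> simp

namespace OrientedMultigraph

/-! ### Minors of the matrix of cycles and chains. -/

section Minors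

variable {V E : Type*} (G : OrientedMultigraph V E)
variable [DecidableEq V] [DecidableEq E] [Fintype E]
variable {𝕜 : Type*} [RCLike 𝕜]

theorem extendCochain_intCast (a : Module.Dual ℤ (E → ℤ)) (z : E → ℤ) :
    extendCochain 𝕜 a (fun e => (z e : 𝕜)) = (a z : ℤ) := by
  conv_rhs => rw [pi_eq_sum_univ' z, map_sum]
  simp only [extendCochain, LinearMap.sum_apply, LinearMap.smul_apply, LinearMap.proj_apply,
    map_smul, smul_eq_mul, Int.cast_sum, Int.cast_mul, mul_comm]

/-- The matrix whose rows are the cycles `γ i` and the chains `φ j`. -/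
def cycleChainMatrix {g k : ℕ} (γ : Fin g → G.cycles ℤ) (φ : Fin k → E → 𝕜) :
    Matrix (Fin g ⊕ Fin k) E 𝕜 :=
  Matrix.of (Sum.elim (fun i e => ((γ i : E → ℤ) e : 𝕜)) φ)

/-- The coordinates of a chain along the chains dual to a basis of the cuts are the values of
these cuts. -/
theorem extendCochain_eq_repr {S : Set E} {g r : ℕ} [Fintype S]
    (γ : Module.Basis (Fin g) ℤ (G.cycles ℤ)) (κ : Module.Basis (Fin r) ℤ (G.quotientCuts ℤ S))
    (ε : Fin r → E → ℤ)
    (hε : ∀ i j, (κ i : Module.Dual ℤ (E → ℤ)) (ε j) = if i = j then 1 else 0)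
    (b : Module.Basis ((Fin g ⊕ Fin r) ⊕ S) 𝕜 (E → 𝕜))
    (hb : ∀ i, b i = fun e => (G.adaptedFamily γ S ε i e : 𝕜)) (j : Fin r) (z : E → 𝕜) :
    extendCochain 𝕜 (κ j : Module.Dual ℤ (E → ℤ)) z = b.repr z (Sum.inl (Sum.inr j)) := by
  have hκ := G.quotientCuts_apply_eq_zero (κ j).2
  have hγ0 : ∀ i, extendCochain 𝕜 (κ j : Module.Dual ℤ (E → ℤ)) (b (Sum.inl (Sum.inl i))) = 0 :=
    fun i => by
      rw [hb, extendCochain_intCast]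
      exact_mod_cast hκ.1 _ (γ i).2
  have hS0 : ∀ s, extendCochain 𝕜 (κ j : Module.Dual ℤ (E → ℤ)) (b (Sum.inr s)) = 0 :=
    fun s => by
      rw [hb, extendCochain_intCast]
      exact_mod_cast hκ.2 _ s.2
  have hε0 : ∀ i, extendCochain 𝕜 (κ j : Module.Dual ℤ (E → ℤ)) (b (Sum.inl (Sum.inr i))) =
      if j = i then 1 else 0 := fun i => by
    rw [hb, extendCochain_intCast]
    exact_mod_cast congrArg (Int.cast : ℤ → 𝕜) (hε j i)
  conv_lhs => rw [← b.sum_repr z]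
  simp only [map_add, map_sum, map_smul, Fintype.sum_sum_type, hγ0, hS0, hε0,
    Finset.sum_const_zero, zero_add, add_zero, smul_eq_mul, mul_ite, mul_one, mul_zero,
    Finset.sum_ite_eq, Finset.mem_univ, if_true]

variable [Fintype V]

/-- Cuts vanish on cycles, after extension of scalars. -/
theorem extendCochain_apply_eq_zero {S : Set E} {a : Module.Dual ℤ (E → ℤ)}
    (ha : a ∈ G.quotientCuts ℤ S) {z : E → 𝕜} (hz : z ∈ G.cycles 𝕜) :
    extendCochain 𝕜 a z = 0 := by
  obtain ⟨f, -, rfl⟩ := ha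
  have : extendCochain 𝕜 (G.coboundary ℤ f) = G.coboundary 𝕜
      (Fintype.linearCombination 𝕜 fun v => ((f (Pi.single v 1) : ℤ) : 𝕜)) := by
    refine LinearMap.pi_ext' fun e => LinearMap.ext_ring ?_
    simp [extendCochain, coboundary_single, Pi.single_apply]
  have hz' : G.boundary 𝕜 z = 0 := hz
  rw [this, coboundary, LinearMap.dualMap_apply, hz', map_zero]

/-- The minor of the complement of an acyclic subgraph in the matrix of the cycles and the given
chains is, up to sign, the pairing of the chains with the cuts of the quotient. -/
theorem norm_det_cycleChainMatrix_submatrix (hG : G.IsConnected) {S : Set E} (hS : G.IsAcyclic S)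
    {g k : ℕ} (γ : Module.Basis (Fin g) ℤ (G.cycles ℤ))
    (κ : Module.Basis (Fin k) ℤ (G.quotientCuts ℤ S)) (φ : Fin k → E → 𝕜)
    (u : (Fin g ⊕ Fin k) ⊕ S ≃ E) (hu : ∀ s, u (Sum.inr s) = s) :
    ‖((G.cycleChainMatrix γ φ).submatrix id (u ∘ Sum.inl)).det‖ =
      ‖exteriorPower.pairingDual 𝕜 (E → 𝕜) k (G.wedgeCuts 𝕜 κ) (exteriorPower.ιMulti 𝕜 k φ)‖ := by
  classical
  have : Fintype S := Fintype.ofFinite S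
  obtain ⟨ε, hε⟩ := G.exists_dual_chains hG κ
  obtain ⟨b, hb⟩ := G.exists_adaptedBasis hS γ κ ε hε
  obtain ⟨b', hb', hdet⟩ := b.exists_extend_int 𝕜 u
  have hb'' : ∀ i, b' i = fun e => (G.adaptedFamily γ S ε i e : 𝕜) := fun i => by
    ext e
    rw [hb', hb]
  -- Bordering by the unit vectors of S completes the minor to a square matrix with the same
  -- determinant, which can be factored through the adapted basis.
  let N : (Fin g ⊕ Fin k) ⊕ S → E → 𝕜 :=
    Sum.elim (G.cycleChainMatrix γ φ) fun s => Pi.single (s : E) 1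
  have hNφ : ∀ i, N (Sum.inl (Sum.inr i)) = φ i := fun i => rfl
  have hNs : ∀ s : S, N (Sum.inr s) = Pi.single (s : E) 1 := fun s => rfl
  have hNγ : ∀ i, N (Sum.inl (Sum.inl i)) = b' (Sum.inl (Sum.inl i)) := fun i => by
    rw [hb'']
    rfl
  have hNS : ∀ s, N (Sum.inr s) = b' (Sum.inr s) := fun s => by
    ext e
    simp [hNs, hb'', adaptedFamily, Pi.single_apply]
  let L : Matrix ((Fin g ⊕ Fin k) ⊕ S) ((Fin g ⊕ Fin k) ⊕ S) 𝕜 :=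
    Matrix.of fun i l => b'.repr (N i) l
  let K : Matrix (Fin k) (Fin k) 𝕜 :=
    Matrix.of fun i j => extendCochain 𝕜 (κ j : Module.Dual ℤ (E → ℤ)) (φ i)
  have h1 : (Matrix.of fun i j => N i (u j)).det =
      ((G.cycleChainMatrix γ φ).submatrix id (u ∘ Sum.inl)).det := by
    have : (Matrix.of fun i j => N i (u j)) = Matrix.fromBlocks
        ((G.cycleChainMatrix γ φ).submatrix id (u ∘ Sum.inl))
        ((G.cycleChainMatrix γ φ).submatrix id (u ∘ Sum.inr)) 0 1 := by
      ext (i | s) (j | s')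
      · rfl
      · rfl
      · have : u (Sum.inl j) ≠ s := by
          rw [← hu]
          exact fun h => Sum.inl_ne_inr (u.injective h)
        simp [hNs, this]
      · simp [hNs, hu, Pi.single_apply, Matrix.one_apply, Subtype.coe_inj, eq_comm]
    rw [this, Matrix.det_fromBlocks_zero₂₁, Matrix.det_one, mul_one]
  have h2 : (Matrix.of fun i j => N i (u j)) = L * Matrix.of fun i j => b' i (u j) := by
    ext i j
    have := congrFun (b'.sum_repr (N i)) (u j)
    rw [Finset.sum_apply] at this
    exact this.symm
  have hcoord := G.extendCochain_eq_repr γ κ ε hε b' hb''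
  -- Only the φ rows are not basis vectors, and their ε-coordinates are the values of the cuts κ.
  have h3 : L.det = K.det := by
    have : L = Matrix.fromBlocks (Matrix.fromBlocks 1 0
        (Matrix.of fun i l => L (Sum.inl (Sum.inr i)) (Sum.inl (Sum.inl l))) K)
        (Matrix.of fun i s => L (Sum.inl i) (Sum.inr s)) 0 1 := by
      ext ((i | i) | s) ((j | j) | s')
      all_goals first | rfl | skip
      · simp [L, hNγ, Finsupp.single_apply, Matrix.one_apply]
      · simp [L, hNγ]
      · simp [L, K, hcoord, hNφ]
      · simp [L, hNS]
      · simp [L, hNS]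
      · simp [L, hNS, Finsupp.single_apply, Matrix.one_apply]
    rw [this, Matrix.det_fromBlocks_zero₂₁, Matrix.det_fromBlocks_zero₁₂, Matrix.det_one,
      Matrix.det_one, mul_one, one_mul]
  rw [← h1, h2, Matrix.det_mul, norm_mul, hdet, mul_one, h3, wedgeCuts,
    exteriorPower.pairingDual_ιMulti_ιMulti]

/-- If a subgraph has a circuit, the minor of its complement vanishes. -/
theorem det_cycleChainMatrix_submatrix_eq_zero {S : Set E} (hS : ¬ G.IsAcyclic S)
    {g k : ℕ} (γ : Module.Basis (Fin g) ℤ (G.cycles ℤ)) (φ : Fin k → E → 𝕜)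
    (p : Fin g ⊕ Fin k → E) (hp : ∀ i, p i ∉ S) :
    ((G.cycleChainMatrix γ φ).submatrix id p).det = 0 := by
  rw [G.isAcyclic_iff_forall_cycles] at hS
  push Not at hS
  obtain ⟨z, hz, hzS, hz0⟩ := hS
  let a := γ.repr ⟨z, hz⟩
  have ha : ∀ e, ∑ i, a i * (γ i : E → ℤ) e = z e := by
    intro e
    have := congrFun (congrArg Subtype.val (γ.sum_repr ⟨z, hz⟩)) e
    rw [AddSubmonoidClass.coe_finsetSum, Finset.sum_apply] at this
    exact this
  -- The coordinates of z along γ, with zeros on the φ rows, give a nonzero linear relation between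
  -- the rows, as z vanishes off S.
  refine Matrix.exists_vecMul_eq_zero_iff.mp
    ⟨Sum.elim (fun i => (a i : 𝕜)) 0, fun h => hz0 ?_, ?_⟩
  · funext e
    have ha0 : ∀ i, a i = 0 := fun i => by
      have := congrFun h (Sum.inl i)
      simpa using this
    simp [← ha, ha0]
  · funext j
    have := congrArg (Int.cast : ℤ → 𝕜) (ha (p j))
    rw [hzS _ (hp j)] at this
    simpa [Matrix.vecMul, dotProduct, cycleChainMatrix] using this

/-- Relation between the numbers of edges and components of an acyclic subgraph and the first
Betti number of the graph. -/
theorem card_eq_of_isAcyclic (hG : G.IsConnected) {F : Finset E} (hF : G.IsAcyclic (F : Set E))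
    {g : ℕ} (γ : Module.Basis (Fin g) ℤ (G.cycles ℤ)) :
    Fintype.card E + 1 = g + G.numComponents (F : Set E) + F.card := by
  let κ := Module.finBasis ℤ (G.quotientCuts ℤ (F : Set E))
  obtain ⟨ε, hε⟩ := G.exists_dual_chains hG κ
  obtain ⟨b, -⟩ := G.exists_adaptedBasis hF γ κ ε hε
  -- Counting the adapted basis gives |E| as g plus the rank of the cuts plus |F|.
  have h := Module.finrank_eq_card_basis b
  rw [Module.finrank_fintype_fun_eq_card] at h
  rw [← G.finrank_quotientCuts_add_one hG, h]
  simp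
  ring

/-- An integral basis of the cycles is a basis of the cycles with coefficients in `𝕜`. -/
theorem exists_extendCycle_basis (hG : G.IsConnected) {g : ℕ}
    (γ : Module.Basis (Fin g) ℤ (G.cycles ℤ)) :
    ∃ b : Module.Basis (Fin g) 𝕜 (G.cycles 𝕜), ∀ i, b i = G.extendCycle (γ i) := by
  classical
  have hS : G.IsAcyclic (∅ : Set E) := fun e he => he.elim
  let κ := Module.finBasis ℤ (G.quotientCuts ℤ (∅ : Set E))
  obtain ⟨ε, hε⟩ := G.exists_dual_chains hG κ
  obtain ⟨b, hb⟩ := G.exists_adaptedBasis hS γ κ ε hε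
  obtain ⟨b', hb', -⟩ := b.exists_extend_int 𝕜 (b.indexEquiv (Pi.basisFun ℤ E))
  have hb'' : ∀ i, b' i = fun e => (G.adaptedFamily γ ∅ ε i e : 𝕜) := fun i => by
    ext e
    rw [hb', hb]
  have hγ : ∀ i, b' (Sum.inl (Sum.inl i)) = ((G.extendCycle (γ i) : G.cycles 𝕜) : E → 𝕜) := fun i => by
    rw [hb'']
    rfl
  have hli : LinearIndependent 𝕜 fun i => (G.extendCycle (γ i) : G.cycles 𝕜) := by
    refine LinearIndependent.of_comp (G.cycles 𝕜).subtype ?_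
    have := b'.linearIndependent.comp (fun i : Fin g => Sum.inl (Sum.inl i))
      (Sum.inl_injective.comp Sum.inl_injective)
    convert this using 1
    ext1 i
    exact (hγ i).symm
  refine ⟨Module.Basis.mk hli ?_, Module.Basis.mk_apply hli _⟩
  rintro ⟨z, hz⟩ -
  have hsum : (⟨z, hz⟩ : G.cycles 𝕜) =
      ∑ i, b'.repr z (Sum.inl (Sum.inl i)) • G.extendCycle (γ i) := by
    ext1
    rw [AddSubmonoidClass.coe_finsetSum]
    refine (b'.sum_repr z).symm.trans ?_
    -- With S empty the adapted basis has only cycles and dual chains; the coordinates along the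
    -- latter are values of cuts, which vanish on a cycle.
    have h0 : ∀ j, b'.repr z (Sum.inl (Sum.inr j)) = 0 := fun j => by
      rw [← G.extendCochain_eq_repr γ κ ε hε b' hb'', G.extendCochain_apply_eq_zero (κ j).2 hz]
    simp only [Fintype.sum_sum_type, h0, hγ, zero_smul, Finset.sum_const_zero, add_zero,
      Finset.univ_eq_empty, Finset.sum_empty]
    rfl
  rw [hsum]
  exact Submodule.sum_mem _ fun i _ => Submodule.smul_mem _ _ (Submodule.subset_span ⟨i, rfl⟩)

end Minors
end OrientedMultigraph

/-- The Cauchy–Binet formula for a weighted Gram matrix. -/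
theorem Matrix.det_mul_diagonal_mul_conjTranspose {𝕜 n m : Type*} [RCLike 𝕜] [Fintype n]
    [DecidableEq n] [Fintype m] [DecidableEq m] (M : Matrix n m 𝕜) (d : m → 𝕜)
    (e : ∀ S : Finset m, S.card = Fintype.card n → (n ≃ S)) :
    (M * Matrix.diagonal d * M.conjTranspose).det =
      ∑ S : Finset m, (∏ a ∈ S, d a) * ((if h : S.card = Fintype.card n then
        ‖(M.submatrix id fun i => (e S h i : m)).det‖ ^ 2 else 0 : ℝ) : 𝕜) := by
  rw [Matrix.det_mul_eq_sum_minors _ _ e]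
  refine Finset.sum_congr rfl fun S _ => ?_
  split_ifs with h
  · have h1 : (M * Matrix.diagonal d).submatrix id (fun i => (e S h i : m)) =
        M.submatrix id (fun i => (e S h i : m)) * Matrix.diagonal fun i => d (e S h i) := by
      ext i j
      simp
    have h2 : M.conjTranspose.submatrix (fun i => (e S h i : m)) id =
        (M.submatrix id fun i => (e S h i : m)).conjTranspose := rfl
    have h3 : ∏ i, d (e S h i) = ∏ a ∈ S, d a := by
      rw [(e S h).prod_comp fun a => d a, Finset.prod_coe_sort]
    rw [h1, h2, Matrix.det_mul, Matrix.det_diagonal, Matrix.det_conjTranspose, h3, RCLike.ofReal_pow,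
      ← RCLike.mul_conj, RCLike.star_def]
    ring
  · simp

namespace OrientedMultigraph

/-! ### From the Gram operator to forests. -/

section Gram

variable {V E : Type*} (G : OrientedMultigraph V E)
variable [DecidableEq V] [DecidableEq E] [Fintype E] [Fintype V]
variable {𝕜 : Type*} [RCLike 𝕜]

/-- The determinant of the Gram operator is the determinant of the Gram matrix of an integral
basis of the cycles and of the given chains. -/
theorem det_box (hG : G.IsConnected) (c : InnerProductSpace.Core 𝕜 (G.cycles 𝕜))
    (hc : G.IsUnimodular c) {g k : ℕ} (γ : Module.Basis (Fin g) ℤ (G.cycles ℤ))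
    (φ : Fin k → E → 𝕜) (x : E → ℝ) (hx : ∀ e, 0 < x e) :
    LinearMap.det (G.box x hx c φ) =
      (G.cycleChainMatrix γ φ * Matrix.diagonal (fun e => (((x e)⁻¹ : ℝ) : 𝕜)) *
        (G.cycleChainMatrix γ φ).conjTranspose).det := by
  obtain ⟨b, hb⟩ := G.exists_extendCycle_basis (𝕜 := 𝕜) hG γ
  let β := b.prod (Pi.basisFun 𝕜 (Fin k))
  have hβl : ∀ i, β (Sum.inl i) = (G.extendCycle (γ i), 0) := fun i => by simp [β, hb]
  have hβr : ∀ i, β (Sum.inr i) = (0, Pi.single i 1) := fun i => by simp [β]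
  have hβ : ∀ i, G.inclusionSum φ (β i) = G.cycleChainMatrix γ φ i := by
    rintro (i | i)
    · rw [hβl, inclusionSum, LinearMap.coprod_apply, map_zero, add_zero]
      rfl
    · rw [hβr, inclusionSum, LinearMap.coprod_apply, map_zero, zero_add,
        Fintype.linearCombination_apply_single, one_smul]
      rfl
  have hinner : ∀ p q : G.cycles 𝕜 × (Fin k → 𝕜), (sumCore c k).inner p q =
      c.inner p.1 q.1 + ∑ i, conj (p.2 i) * q.2 i := fun _ _ => rfl
  have hgram : (Matrix.of fun i j => (sumCore c k).inner (β i) (β j)).det = 1 := by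
    have h0l : ∀ z, c.inner 0 z = 0 := fun z => by
      simpa using c.smul_left 0 z 0
    have h0r : ∀ z, c.inner z 0 = 0 := fun z => by
      rw [← c.conj_inner_symm, h0l, map_zero]
    have : (Matrix.of fun i j => (sumCore c k).inner (β i) (β j)) = Matrix.fromBlocks
        (Matrix.of fun i j => c.inner (G.extendCycle (γ i)) (G.extendCycle (γ j))) 0 0 1 := by
      ext (i | i) (j | j)
      · simp [hinner, hβl]
      · simp [hinner, hβl, hβr, h0r]
      · simp [hinner, hβl, hβr, h0l]
      · simp [hinner, hβr, h0l, Matrix.one_apply, Pi.single_apply, eq_comm]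
    rw [this, Matrix.det_fromBlocks_zero₂₁, hc, Matrix.det_one, mul_one]
  have h := (sumCore c k).det_inner_apply β (G.box x hx c φ)
  rw [hgram, one_mul] at h
  -- Because `J` is antilinear, the matrix of ⟨β i, □ β j⟩ is the transpose of M D M*.
  rw [← h, ← Matrix.det_transpose]
  congr 1
  ext i j
  have hJ : ∀ i e, J x (G.inclusionSum φ (β i)) (Pi.single e 1) =
      (((x e)⁻¹ : ℝ) : 𝕜) * conj (G.cycleChainMatrix γ φ i e) := by
    intro i e
    rw [hβ]
    simp [J, Pi.single_apply]
  change (sumCore c k).inner (β j) (G.box x hx c φ (β i)) = _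
  rw [← (sumCore c k).conj_inner_symm]
  change conj ((sumCore c k).inner (antilinearAdjoint (sumCore c k) (formCore x hx)
    ((J x).comp (G.inclusionSum φ)) (J x (G.inclusionSum φ (β i)))) (β j)) = _
  rw [← antilinearAdjoint_spec]
  change conj (∑ e, (x e : 𝕜) * (conj (J x (G.inclusionSum φ (β j)) (Pi.single e 1)) *
    J x (G.inclusionSum φ (β i)) (Pi.single e 1))) = _
  rw [Matrix.mul_apply, map_sum]
  refine Finset.sum_congr rfl fun e _ => ?_
  have hxe : (x e : 𝕜) ≠ 0 := by exact_mod_cast (hx e).ne'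
  rw [hJ, hJ, Matrix.mul_diagonal, Matrix.conjTranspose_apply]
  simp only [map_mul, RCLike.conj_conj, RCLike.conj_ofReal, RCLike.star_def]
  rw [RCLike.ofReal_inv]
  field_simp

/-- The squared norms of the maximal minors of the matrix of the cycles and the given chains. -/
theorem norm_minor_sq_eq (hG : G.IsConnected) {g k : ℕ}
    (γ : Module.Basis (Fin g) ℤ (G.cycles ℤ)) (φ : Fin k → E → 𝕜) (F : Finset E)
    (e : Fᶜ.card = Fintype.card (Fin g ⊕ Fin k) → (Fin g ⊕ Fin k ≃ (Fᶜ : Finset E))) :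
    (if h : Fᶜ.card = Fintype.card (Fin g ⊕ Fin k) then
      ‖((G.cycleChainMatrix γ φ).submatrix id fun i => (e h i : E)).det‖ ^ 2 else 0) =
    if F ∈ G.forests (k + 1) then
      G.cutWeight (exteriorPower.ιMulti 𝕜 k φ) (F : Set E) else 0 := by
  have hmem : F ∈ G.forests (k + 1) ↔
      G.IsAcyclic (F : Set E) ∧ G.numComponents (F : Set E) = k + 1 := by
    simp [forests]
  have hcard : Fᶜ.card + F.card = Fintype.card E := by
    rw [Finset.card_compl, Nat.sub_add_cancel (Finset.card_le_univ F)]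
  by_cases hac : G.IsAcyclic (F : Set E)
  · have hE := G.card_eq_of_isAcyclic hG hac γ
    have hiff : Fᶜ.card = Fintype.card (Fin g ⊕ Fin k) ↔ F ∈ G.forests (k + 1) := by
      rw [hmem, Fintype.card_sum, Fintype.card_fin, Fintype.card_fin]
      refine ⟨fun h => ⟨hac, by omega⟩, fun h => by have := h.2; omega⟩
    by_cases h : Fᶜ.card = Fintype.card (Fin g ⊕ Fin k)
    · rw [dif_pos h, if_pos (hiff.mp h)]
      have hrank : Module.finrank ℤ (G.quotientCuts ℤ (F : Set E)) = k := by
        have := G.finrank_quotientCuts_add_one hG (F : Set E)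
        have := (hmem.mp (hiff.mp h)).2
        omega
      let κ := Module.finBasisOfFinrankEq ℤ (G.quotientCuts ℤ (F : Set E)) hrank
      let u : (Fin g ⊕ Fin k) ⊕ (F : Set E) ≃ E :=
        Equiv.ofBijective (Sum.elim (fun i => (e h i : E)) fun s => s) (by
          constructor
          · refine Function.Injective.sumElim (Subtype.val_injective.comp (e h).injective)
              Subtype.val_injective fun i s his => ?_
            exact Finset.mem_compl.mp (e h i).2 (his ▸ s.2)
          · intro a
            by_cases ha : a ∈ F
            · exact ⟨Sum.inr ⟨a, ha⟩, rfl⟩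
            · exact ⟨Sum.inl ((e h).symm ⟨a, Finset.mem_compl.mpr ha⟩), by simp⟩)
      rw [G.cutWeight_eq _ κ, ← G.norm_det_cycleChainMatrix_submatrix hG hac γ κ φ u fun _ => rfl]
      rfl
    · rw [dif_neg h, if_neg (mt hiff.mpr h)]
  · rw [if_neg fun h => hac (hmem.mp h).1]
    split_ifs with h
    · rw [G.det_cycleChainMatrix_submatrix_eq_zero hac γ φ _ fun i =>
        Finset.mem_compl.mp (e h i).2]
      simp
    · rfl

end Gram
end OrientedMultigraph

theorem mainTheorem8 {V E : Type*} [Fintype V] [DecidableEq V] [Fintype E] [DecidableEq E]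
    {𝕜 : Type*} [RCLike 𝕜] (G : OrientedMultigraph V E) (hG : G.IsConnected)
    (c : InnerProductSpace.Core 𝕜 (G.cycles 𝕜)) (hc : G.IsUnimodular c)
    (k : ℕ) (φ : Fin k → E → 𝕜) (x : E → ℝ) (hx : ∀ e, 0 < x e) :
    ((MvPolynomial.eval x (G.forestPolynomial (exteriorPower.ιMulti 𝕜 k φ)) : ℝ) : 𝕜) =
      ((∏ e, x e : ℝ) : 𝕜) * LinearMap.det (G.box x hx c φ) := by
  obtain ⟨g, γ⟩ := Submodule.basisOfPid (Pi.basisFun ℤ E) (G.cycles ℤ)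
  let e : ∀ S : Finset E, S.card = Fintype.card (Fin g ⊕ Fin k) → (Fin g ⊕ Fin k ≃ S) :=
    fun S h => Fintype.equivOfCardEq (by rw [← h, Fintype.card_coe])
  rw [G.det_box hG c hc γ φ x hx, Matrix.det_mul_diagonal_mul_conjTranspose _ _ e,
    -- The expansion runs over the column sets of the minors; forests are their complements.
    ← compl_bijective.sum_comp, Finset.mul_sum]
  simp only [G.norm_minor_sq_eq hG γ φ _ (e _)]
  have hprod : ∀ F : Finset E, ((∏ a, x a : ℝ) : 𝕜) * ∏ a ∈ Fᶜ, (((x a)⁻¹ : ℝ) : 𝕜) =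
      ((∏ a ∈ F, x a : ℝ) : 𝕜) := by
    intro F
    rw [← RCLike.ofReal_prod, ← RCLike.ofReal_mul, ← Finset.prod_mul_prod_compl F x, mul_assoc,
      ← Finset.prod_mul_distrib, Finset.prod_congr rfl fun a _ => mul_inv_cancel₀ (hx a).ne',
      Finset.prod_const_one, mul_one]
  simp only [← mul_assoc, hprod, ← RCLike.ofReal_mul, ← RCLike.ofReal_sum]
  congr 1
  simp only [OrientedMultigraph.forestPolynomial, map_sum, map_mul, map_prod, MvPolynomial.eval_C,
    MvPolynomial.eval_X, mul_ite, mul_zero, Finset.sum_ite_mem, Finset.univ_inter, mul_comm]
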